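/- Let $A\in\mathbb R^{n_x\times n_x}$, $B_u\in\mathbb R^{n_x\times n_u}$, $B_w\in\mathbb R^{n_x\times n_w}$, $C_z\in\mathbb R^{n_z\times n_x}$, $D_{wz}\in\mathbb R^{n_z\times n_w}$, $H\in\mathbb R^{m\times N}$, $h\in\mathbb R^m$, $\alpha_\pi\in\mathbb R^N$, let $\alpha,\eta>0$, and let $n_u=n_{u_1}+\dots+n_{u_N}$. The variable is $p=(S,\zeta,Z,\pi)$ with $S\in\mathbb S^{n_x}$ (symmetric), $\zeta\in\mathbb R$, $Z\in\mathbb R^{n_u\times n_x}$, $\pi\in\mathbb R^N$, regarded as a vector of a Euclidean space; put $\Pi=\mathrm{blkdiag}(\pi_1I_{n_{u_1}},\dots,\pi_NI_{n_{u_N}})$. The relaxed problem is $$L=\inf_p\ f(p)=(\eta+1)\zeta+\alpha_\pi^\top\pi\quad\text{subject to}\quad \mathcal G(p)\preceq O,$$ where $\mathcal G(p)$ is the block diagonal matrix with blocks $$F_1(p)=\begin{bmatrix}AS+SA^\top+\alpha S-B_u\Pi Z-Z^\top\Pi B_u^\top&B_w\\B_w^\top&-\alpha\eta I\end{bmatrix},\quad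 F_2(p)=\begin{bmatrix}-S&O&SC_z^\top\\O&-I&D_{wz}^\top\\C_zS&D_{wz}&-\zeta I\end{bmatrix},$$ $\mathrm{diag}(H\pi-h)$, $\mathrm{diag}(-\pi)$ and $\mathrm{diag}(\pi-\mathbf 1)$. A feasible point $p$ satisfies the Mangasarian--Fromovitz constraint qualification (MFCQ) if $\mathcal G(p)+[D\mathcal G(p)]q\prec O$ for some $q$. A point $p^*$ is stationary for the relaxed problem if there is a symmetric $\Lambda\succeq O$ with $\nabla_p\big(f(p)+\mathrm{trace}[\Lambda\mathcal G(p)]\big)\big|_{p=p^*}=0$, $\mathcal G(p^*)\preceq O$ and $\Lambda\,\mathcal G(p^*)=O$. Fix constants $\rho,c_1,c_2,c_3>0$. Start from $Q_0=I$ and any feasible point $p_0$ of the relaxed problem (for instance an interior point). For $k=1,2,\dots$ let $(p_k,Q_k)$ be a solution of $$\hat L_k=\min_{p,\,Q\in\mathbb S^{n_u}}\ f(p)+\rho J_k(p)$$ subject to $\mathcal K_s(p,Q;p_{k-1},Q_{k-1})\preceq O$, $c_1I\preceq Q\preceq c_2I$, $-2Q_{k-1}+Q\preceq -c_3I$, $F_2(p)\preceq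 O$, $H\pi\le h$, $\mathbf 0\le\pi\le\mathbf 1$. Here $J_k(p)=|\zeta-\zeta_{k-1}|^2+\|S-S_{k-1}\|_F^2+\|Z-Z_{k-1}\|_F^2+\|\Pi-\Pi_{k-1}\|_F^2$ and, with $\Delta\Pi=\Pi-\Pi_{k-1}$ and $\Delta Z=Z-Z_{k-1}$, $$\mathcal K_s(p,Q;p_{k-1},Q_{k-1})=\begin{bmatrix}\Omega&B_w&B_u\Delta\Pi\,Q_{k-1}&\Delta Z^\top\\B_w^\top&-\alpha\eta I&O&O\\Q_{k-1}\Delta\Pi B_u^\top&O&-2Q_{k-1}+Q&O\\\Delta Z&O&O&-Q\end{bmatrix},$$ $$\begin{aligned}\Omega={}&-B_u\Pi_{k-1}Z_{k-1}-Z_{k-1}^\top\Pi_{k-1}B_u^\top+AS+SA^\top+\alpha S-B_u\Pi_{k-1}\Delta Z-\Delta Z^\top\Pi_{k-1}B_u^\top\\&-B_u\Delta\Pi Z_{k-1}-Z_{k-1}^\top\Delta\Pi B_u^\top.\end{aligned}$$ Assume that MFCQ holds at every feasible point of the relaxed problem and that $\{p_k\}_{k\ge1}$ is bounded. Then: (a)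 $f(p_k)\ge L$ and $\hat L_k\ge L$ for $k=1,2,\dots$. (b) The sequence $\{f(p_k)\}_{k\ge1}$ is monotone decreasing (nonincreasing) and converges to a limit $\hat f\ge L$. (c) Every limit point of $\{p_k\}_{k\ge1}$ is a stationary point of the relaxed problem. -/

import Mathlib

open Matrix Filter Topology

/-- The subspace of symmetric matrices of size `n`. -/
def SymMat (n : ℕ) : Submodule ℝ (Matrix (Fin n) (Fin n) ℝ) where
  carrier := {S | Sᵀ = S}
  add_mem' := by
    intro a b ha hb
    simp only [Set.mem_ofPred_eq, Matrix.transpose_add] at *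
    rw [ha, hb]
  zero_mem' := by simp
  smul_mem' := by
    intro c a ha
    simp only [Set.mem_ofPred_eq, Matrix.transpose_smul] at *
    rw [ha]

/-- `M ⪯ 0` in the Loewner order. -/
def NegSemidef {ι : Type*} (M : Matrix ι ι ℝ) : Prop := (-M).PosSemidef

/-- `M ≺ 0` in the Loewner order. -/
def NegDef {ι : Type*} (M : Matrix ι ι ℝ) : Prop := (-M).PosDef

/-- The squared Frobenius norm. -/
def frobSq {ι κ : Type*} [Fintype ι] [Fintype κ] (M : Matrix ι κ ℝ) : ℝ :=
  ∑ i, ∑ j, M i j ^ 2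

/-- The index set of all inputs: node `i` carries `nu i` inputs. -/
abbrev InputIdx {N : ℕ} (nu : Fin N → ℕ) : Type := (i : Fin N) × Fin (nu i)

/-- The optimization variable `p = (S, ζ, Z, π)`, with `S` symmetric; a finite-dimensional real
vector space with its usual topology. -/
abbrev Vars (nx : ℕ) {N : ℕ} (nu : Fin N → ℕ) : Type :=
  SymMat nx × ℝ × Matrix (InputIdx nu) (Fin nx) ℝ × (Fin N → ℝ)

namespace Vars

variable {nx N : ℕ} {nu : Fin N → ℕ}

/-- The symmetric matrix variable. -/
def S (p : Vars nx nu) : Matrix (Fin nx) (Fin nx) ℝ := (p.1 : Matrix (Fin nx) (Fin nx) ℝ)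

/-- The performance index variable. -/
def zeta (p : Vars nx nu) : ℝ := p.2.1

/-- The (unscaled) gain variable. -/
def Z (p : Vars nx nu) : Matrix (InputIdx nu) (Fin nx) ℝ := p.2.2.1

/-- The actuator selection vector. -/
def sel (p : Vars nx nu) : Fin N → ℝ := p.2.2.2

/-- `Π = blkdiag(π₁ I, …, π_N I)`, the `i`-th identity having size `nu i`. -/
def selMat (p : Vars nx nu) : Matrix (InputIdx nu) (InputIdx nu) ℝ :=
  Matrix.diagonal fun a => p.sel a.1

/-- The squared Euclidean norm of `p` regarded as a vector. -/
def normSq (p : Vars nx nu) : ℝ :=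
  frobSq p.S + p.zeta ^ 2 + frobSq p.Z + ∑ i, p.sel i ^ 2

/-- The proximal regularizer
`|ζ - ζ'|² + ‖S - S'‖_F² + ‖Z - Z'‖_F² + ‖Π - Π'‖_F²`. -/
def prox (p p' : Vars nx nu) : ℝ :=
  (p.zeta - p'.zeta) ^ 2 + frobSq (p.S - p'.S) + frobSq (p.Z - p'.Z)
    + frobSq (p.selMat - p'.selMat)

end Vars

/-- The data of the actuator selection problem: `nx` states, `nw` disturbances, `nz` performance
outputs, `N` nodes with `nu i` inputs at node `i`, and `m` linear coupling constraints. -/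
structure SelData (nx nw nz m : ℕ) {N : ℕ} (nu : Fin N → ℕ) where
  /-- State matrix. -/
  A : Matrix (Fin nx) (Fin nx) ℝ
  /-- Input matrix. -/
  Bu : Matrix (Fin nx) (InputIdx nu) ℝ
  /-- Disturbance matrix. -/
  Bw : Matrix (Fin nx) (Fin nw) ℝ
  /-- Performance output matrix. -/
  Cz : Matrix (Fin nz) (Fin nx) ℝ
  /-- Disturbance feedthrough matrix. -/
  Dwz : Matrix (Fin nz) (Fin nw) ℝ
  /-- The constant `α`. -/
  alpha : ℝ
  /-- The constant `η`. -/
  eta : ℝ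
  /-- Actuator weights. -/
  alphaPi : Fin N → ℝ
  /-- Coupling matrix. -/
  H : Matrix (Fin m) (Fin N) ℝ
  /-- Coupling right-hand side. -/
  h : Fin m → ℝ

namespace SelData

variable {nx nw nz m N : ℕ} {nu : Fin N → ℕ}

/-- The index set of the block diagonal constraint matrix. -/
abbrev ConIdx (nx nw nz m N : ℕ) : Type :=
  (Fin nx ⊕ Fin nw) ⊕ (((Fin nx ⊕ Fin nw) ⊕ Fin nz) ⊕ (Fin m ⊕ (Fin N ⊕ Fin N)))

/-- The objective `f(p) = (η + 1) ζ + α_πᵀ π`. -/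
def f (D : SelData nx nw nz m nu) (p : Vars nx nu) : ℝ :=
  (D.eta + 1) * p.zeta + D.alphaPi ⬝ᵥ p.sel

/-- The left-hand side of the bilinear matrix inequality. -/
def F1 (D : SelData nx nw nz m nu) (p : Vars nx nu) :
    Matrix (Fin nx ⊕ Fin nw) (Fin nx ⊕ Fin nw) ℝ :=
  Matrix.fromBlocks
    (D.A * p.S + p.S * D.Aᵀ + D.alpha • p.S
      - D.Bu * p.selMat * p.Z - p.Zᵀ * p.selMat * D.Buᵀ)
    D.Bw
    D.Bwᵀ
    (-((D.alpha * D.eta) • (1 : Matrix (Fin nw) (Fin nw) ℝ)))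

/-- The left-hand side of the linear matrix inequality in `S` and `ζ`. -/
def F2 (D : SelData nx nw nz m nu) (p : Vars nx nu) :
    Matrix ((Fin nx ⊕ Fin nw) ⊕ Fin nz) ((Fin nx ⊕ Fin nw) ⊕ Fin nz) ℝ :=
  Matrix.fromBlocks
    (Matrix.fromBlocks (-p.S) 0 0 (-1))
    (Matrix.fromRows (p.S * D.Czᵀ) D.Dwzᵀ)
    (Matrix.fromCols (D.Cz * p.S) D.Dwz)
    (-(p.zeta • (1 : Matrix (Fin nz) (Fin nz) ℝ)))

/-- The block diagonal constraint function of the relaxed problem; its blocks are the two matrix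
inequalities, `H π - h`, `-π` and `π - 1`. -/
def G (D : SelData nx nw nz m nu) (p : Vars nx nu) :
    Matrix (ConIdx nx nw nz m N) (ConIdx nx nw nz m N) ℝ :=
  Matrix.fromBlocks (D.F1 p) 0 0
    (Matrix.fromBlocks (D.F2 p) 0 0
      (Matrix.fromBlocks (Matrix.diagonal (D.H *ᵥ p.sel - D.h)) 0 0
        (Matrix.fromBlocks (Matrix.diagonal (-p.sel)) 0 0 (Matrix.diagonal (p.sel - 1)))))

/-- The feasible set `{p | G(p) ⪯ 0}` of the relaxed problem. -/
def feasible (D : SelData nx nw nz m nu) : Set (Vars nx nu) := {p | NegSemidef (D.G p)}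

/-- The optimal value of the relaxed problem, as an extended real number. -/
noncomputable def optVal (D : SelData nx nw nz m nu) : EReal :=
  ⨅ p ∈ D.feasible, (D.f p : EReal)

/-- The differential `[DG(p)] q`, entry by entry (the entries of `G` are quadratic polynomials, so
the differential applied to `q` is the derivative along `q`). -/
noncomputable def DG (D : SelData nx nw nz m nu) (p q : Vars nx nu) :
    Matrix (ConIdx nx nw nz m N) (ConIdx nx nw nz m N) ℝ :=
  Matrix.of fun i j => lineDeriv ℝ (fun p' => D.G p' i j) p q

/-- The Mangasarian-Fromovitz constraint qualification at `p`. -/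
def MFCQ (D : SelData nx nw nz m nu) (p : Vars nx nu) : Prop :=
  ∃ q : Vars nx nu, NegDef (D.G p + D.DG p q)

/-- The Lagrangian `f(p) + trace(Λ G(p))`. -/
def lagrangian (D : SelData nx nw nz m nu) (p : Vars nx nu)
    (Lam : Matrix (ConIdx nx nw nz m N) (ConIdx nx nw nz m N) ℝ) : ℝ :=
  D.f p + Matrix.trace (Lam * D.G p)

/-- `(p, Λ)` is a KKT point of the relaxed problem. The Lagrangian is polynomial in `p`, so its
gradient vanishes exactly when all its directional derivatives vanish. -/
structure IsKKT (D : SelData nx nw nz m nu) (p : Vars nx nu)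
    (Lam : Matrix (ConIdx nx nw nz m N) (ConIdx nx nw nz m N) ℝ) : Prop where
  stationarity : ∀ q : Vars nx nu, HasLineDerivAt ℝ (fun p' => D.lagrangian p' Lam) 0 p q
  primal : NegSemidef (D.G p)
  dual : Lam.PosSemidef
  slackness : Lam * D.G p = 0

/-- `p` is a stationary point of the relaxed problem. -/
def IsStationary (D : SelData nx nw nz m nu) (p : Vars nx nu) : Prop :=
  ∃ Lam : Matrix (ConIdx nx nw nz m N) (ConIdx nx nw nz m N) ℝ, D.IsKKT p Lam

/-- The upper left block `Ω(p; p')` of the surrogate constraint, with `p'` the current point. -/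
def Omega (D : SelData nx nw nz m nu) (p p' : Vars nx nu) : Matrix (Fin nx) (Fin nx) ℝ :=
  -(D.Bu * p'.selMat * p'.Z) - p'.Zᵀ * p'.selMat * D.Buᵀ
    + D.A * p.S + p.S * D.Aᵀ + D.alpha • p.S
    - D.Bu * p'.selMat * (p.Z - p'.Z) - (p.Z - p'.Z)ᵀ * p'.selMat * D.Buᵀ
    - D.Bu * (p.selMat - p'.selMat) * p'.Z - p'.Zᵀ * (p.selMat - p'.selMat) * D.Buᵀ

/-- The surrogate constraint function `K_s(p, Q; p', Q')`, affine in `(p, Q)`. -/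
def Ks (D : SelData nx nw nz m nu) (p : Vars nx nu) (Q : Matrix (InputIdx nu) (InputIdx nu) ℝ)
    (p' : Vars nx nu) (Q' : Matrix (InputIdx nu) (InputIdx nu) ℝ) :
    Matrix ((Fin nx ⊕ Fin nw) ⊕ (InputIdx nu ⊕ InputIdx nu))
      ((Fin nx ⊕ Fin nw) ⊕ (InputIdx nu ⊕ InputIdx nu)) ℝ :=
  Matrix.fromBlocks
    (Matrix.fromBlocks (D.Omega p p') D.Bw D.Bwᵀ
      (-((D.alpha * D.eta) • (1 : Matrix (Fin nw) (Fin nw) ℝ))))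
    (Matrix.fromBlocks (D.Bu * (p.selMat - p'.selMat) * Q') (p.Z - p'.Z)ᵀ 0 0)
    (Matrix.fromBlocks (Q' * (p.selMat - p'.selMat) * D.Buᵀ) 0 (p.Z - p'.Z) 0)
    (Matrix.fromBlocks (-((2 : ℝ) • Q') + Q) 0 0 (-Q))

/-- The feasible set, in the variables `(p, Q)`, of the convex subproblem built at `(p', Q')`. -/
structure SubFeasible (D : SelData nx nw nz m nu) (c₁ c₂ c₃ : ℝ)
    (p' : Vars nx nu) (Q' : Matrix (InputIdx nu) (InputIdx nu) ℝ)
    (p : Vars nx nu) (Q : Matrix (InputIdx nu) (InputIdx nu) ℝ) : Prop where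
  symm : Qᵀ = Q
  surrogate : NegSemidef (D.Ks p Q p' Q')
  lower : (Q - c₁ • (1 : Matrix (InputIdx nu) (InputIdx nu) ℝ)).PosSemidef
  upper : (c₂ • (1 : Matrix (InputIdx nu) (InputIdx nu) ℝ) - Q).PosSemidef
  gap : NegSemidef
    ((-((2 : ℝ) • Q') + Q) + c₃ • (1 : Matrix (InputIdx nu) (InputIdx nu) ℝ))
  lmi : NegSemidef (D.F2 p)
  coupling : D.H *ᵥ p.sel ≤ D.h
  box_lower : 0 ≤ p.sel
  box_upper : p.sel ≤ 1

/-- The objective of the convex subproblem. -/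
def subObj (D : SelData nx nw nz m nu) (ρ : ℝ) (p' p : Vars nx nu) : ℝ :=
  D.f p + ρ * p.prox p'

/-- The optimal value of the convex subproblem built at `(p', Q')`, as an extended real number. -/
noncomputable def subVal (D : SelData nx nw nz m nu) (ρ c₁ c₂ c₃ : ℝ)
    (p' : Vars nx nu) (Q' : Matrix (InputIdx nu) (InputIdx nu) ℝ) : EReal :=
  ⨅ (p : Vars nx nu) (Q : Matrix (InputIdx nu) (InputIdx nu) ℝ)
    (_ : D.SubFeasible c₁ c₂ c₃ p' Q' p Q), (D.subObj ρ p' p : EReal)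

/-- `(p, Q)` solves the convex subproblem built at `(p', Q')`. -/
def IsSubSolution (D : SelData nx nw nz m nu) (ρ c₁ c₂ c₃ : ℝ)
    (p' : Vars nx nu) (Q' : Matrix (InputIdx nu) (InputIdx nu) ℝ)
    (p : Vars nx nu) (Q : Matrix (InputIdx nu) (InputIdx nu) ℝ) : Prop :=
  D.SubFeasible c₁ c₂ c₃ p' Q' p Q ∧
    ∀ (r : Vars nx nu) (R : Matrix (InputIdx nu) (InputIdx nu) ℝ),
      D.SubFeasible c₁ c₂ c₃ p' Q' r R → D.subObj ρ p' p ≤ D.subObj ρ p' r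

/-- `(p k, Q k)` is a run of the parametric successive convex approximation: the start is a
feasible point and the identity, and the `(k + 1)`-st iterate solves the subproblem built at the
`k`-th one. -/
structure IsRun (D : SelData nx nw nz m nu) (ρ c₁ c₂ c₃ : ℝ)
    (p : ℕ → Vars nx nu) (Q : ℕ → Matrix (InputIdx nu) (InputIdx nu) ℝ) : Prop where
  init_p : p 0 ∈ D.feasible
  init_Q : Q 0 = 1
  step : ∀ k, D.IsSubSolution ρ c₁ c₂ c₃ (p k) (Q k) (p (k + 1)) (Q (k + 1))

end SelData

/-! ### Loewner order and the multiplier theorem -/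

section MatrixLemmas

variable {ι κ : Type*}

/-! Parts (a) and (b) rest on two facts about the surrogate. A congruence carries `Ks` exactly to
`F1`, whatever `Q` and `Q'` are, so every subproblem-feasible point is feasible for the relaxed
problem. Conversely the current point, paired with the new `Q`, is subproblem-feasible at zero
proximal cost. Hence `f` decreases along the run, and boundedness of the iterates bounds it below.

For (c), suppose a limit point `r` is not stationary. By MFCQ and a Hahn-Banach separation
(`exists_multiplier`), there is a direction `d` with `G r + dG r d ≺ 0` and `f d < 0`. The surrogate
agrees with `F1` to first order, so a short step `r + t d` satisfies it strictly at `r`. The bounds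
on `Q` allow this to be expressed by a condition free of `Q` (`margin`), which is open in the base
point. So `r + t d` is a competitor at every iterate close to `r`, and optimality followed by a
limit gives `lim f ≤ f r + t f d + O(t²)`. For small `t` this contradicts `lim f = f r`. Neither
convergence of `Q k` nor vanishing of successive steps is needed. -/

theorem NegDef.negSemidef {M : Matrix ι ι ℝ} (h : NegDef M) : NegSemidef M :=
  PosDef.posSemidef h

theorem NegSemidef.add {M M' : Matrix ι ι ℝ} (h : NegSemidef M) (h' : NegSemidef M') :
    NegSemidef (M + M') := by
  have := PosSemidef.add h h'
  rwa [NegSemidef, neg_add]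

theorem NegSemidef.smul {M : Matrix ι ι ℝ} (h : NegSemidef M) {c : ℝ} (hc : 0 ≤ c) :
    NegSemidef (c • M) := by
  have := PosSemidef.smul h hc
  rwa [NegSemidef, ← smul_neg]

theorem NegDef.smul {M : Matrix ι ι ℝ} (h : NegDef M) {c : ℝ} (hc : 0 < c) :
    NegDef (c • M) := by
  have := PosDef.smul h hc
  rwa [NegDef, ← smul_neg]

theorem NegSemidef.add_negDef {M M' : Matrix ι ι ℝ} (h : NegSemidef M) (h' : NegDef M') :
    NegDef (M + M') := by
  have := PosDef.posSemidef_add h h'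
  rwa [NegDef, neg_add]

theorem negSemidef_diagonal [DecidableEq ι] {d : ι → ℝ} :
    NegSemidef (diagonal d) ↔ d ≤ 0 := by
  rw [NegSemidef, diagonal_neg, posSemidef_diagonal_iff]
  simp [Pi.le_def]

theorem NegDef.fromBlocks_left {A : Matrix ι ι ℝ} {B : Matrix ι κ ℝ} {C : Matrix κ ι ℝ}
    {D : Matrix κ κ ℝ} (h : NegDef (fromBlocks A B C D)) : NegDef A :=
  PosDef.submatrix h (e := Sum.inl) Sum.inl_injective

/-- The symmetric matrix representing a linear functional on symmetric matrices through the trace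
pairing. -/
noncomputable def symmetricRepr [DecidableEq ι] (φ : Matrix ι ι ℝ →ₗ[ℝ] ℝ) : Matrix ι ι ℝ :=
  Matrix.of fun i j => (φ (single i j 1) + φ (single j i 1)) / 2

theorem isSymm_symmetricRepr [DecidableEq ι] (φ : Matrix ι ι ℝ →ₗ[ℝ] ℝ) :
    (symmetricRepr φ).IsSymm := by
  ext i j
  simp [symmetricRepr, add_comm]

variable [Fintype ι] [Fintype κ]

theorem negSemidef_iff {M : Matrix ι ι ℝ} :
    NegSemidef M ↔ M.IsSymm ∧ ∀ v : ι → ℝ, v ⬝ᵥ M *ᵥ v ≤ 0 := by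
  rw [NegSemidef, posSemidef_iff_dotProduct_mulVec]
  simp [IsHermitian, IsSymm, conjTranspose_eq_transpose_of_trivial, neg_mulVec]

theorem negDef_iff {M : Matrix ι ι ℝ} :
    NegDef M ↔ M.IsSymm ∧ ∀ v : ι → ℝ, v ≠ 0 → v ⬝ᵥ M *ᵥ v < 0 := by
  rw [NegDef, posDef_iff_dotProduct_mulVec]
  simp [IsHermitian, IsSymm, conjTranspose_eq_transpose_of_trivial, neg_mulVec]

theorem posSemidef_fromBlocks_zero {A : Matrix ι ι ℝ} {B : Matrix κ κ ℝ} :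
    (fromBlocks A 0 0 B).PosSemidef ↔ A.PosSemidef ∧ B.PosSemidef := by
  refine ⟨fun h => ⟨h.submatrix Sum.inl, h.submatrix Sum.inr⟩, fun ⟨hA, hB⟩ => ?_⟩
  refine .of_dotProduct_mulVec_nonneg (hA.1.fromBlocks (by simp) hB.1) fun v => ?_
  have h1 := hA.dotProduct_mulVec_nonneg (v ∘ Sum.inl)
  have h2 := hB.dotProduct_mulVec_nonneg (v ∘ Sum.inr)
  rw [fromBlocks_mulVec, ← Sum.elim_comp_inl_inr (star v), sumElim_dotProduct_sumElim]
  simpa using add_nonneg h1 h2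

theorem negSemidef_fromBlocks_zero {A : Matrix ι ι ℝ} {B : Matrix κ κ ℝ} :
    NegSemidef (fromBlocks A 0 0 B) ↔ NegSemidef A ∧ NegSemidef B := by
  simp [NegSemidef, fromBlocks_neg, posSemidef_fromBlocks_zero]

/-- Negative definiteness of the quadratic form of a matrix is an open condition. -/
theorem isOpen_setOf_quadraticForm_neg :
    IsOpen {M : Matrix ι ι ℝ | ∀ v : ι → ℝ, v ≠ 0 → v ⬝ᵥ M *ᵥ v < 0} := by
  rw [isOpen_iff_mem_nhds]
  intro M hM
  -- Compactness of the sphere makes one neighbourhood work for all unit vectors; homogeneity does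
  -- the rest.
  have hev : ∀ᶠ M' in 𝓝 M, ∀ v ∈ Metric.sphere (0 : ι → ℝ) 1, v ⬝ᵥ M' *ᵥ v < 0 := by
    refine (isCompact_sphere (0 : ι → ℝ) 1).eventually_forall_of_forall_eventually fun v hv => ?_
    have hc : Continuous fun z : Matrix ι ι ℝ × (ι → ℝ) => z.2 ⬝ᵥ z.1 *ᵥ z.2 := by fun_prop
    exact hc.continuousAt.eventually_lt continuousAt_const
      (hM v (by rintro rfl; simp at hv))
  filter_upwards [hev] with M' h v hv
  have hn : 0 < ‖v‖ := norm_pos_iff.2 hv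
  have h1 := h (‖v‖⁻¹ • v) (by simp [norm_smul, hn.ne'])
  rw [mulVec_smul, dotProduct_smul, smul_dotProduct, smul_eq_mul, smul_eq_mul] at h1
  have h2 : 0 < ‖v‖⁻¹ := inv_pos.2 hn
  by_contra hcon
  exact absurd h1 (not_lt.2 (mul_nonneg h2.le (mul_nonneg h2.le (not_lt.1 hcon))))

/-- Symmetry is a separate hypothesis because only the sign of the quadratic form is an open
condition. -/
theorem NegDef.eventually_of_tendsto {α : Type*} {l : Filter α} {M : α → Matrix ι ι ℝ}
    {M₀ : Matrix ι ι ℝ} (h : NegDef M₀) (hlim : Tendsto M l (𝓝 M₀)) (hM : ∀ a, (M a).IsSymm) :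
    ∀ᶠ a in l, NegDef (M a) := by
  have := hlim.eventually (isOpen_setOf_quadraticForm_neg.mem_nhds (negDef_iff.1 h).2)
  filter_upwards [this] with a ha
  exact negDef_iff.2 ⟨hM a, ha⟩

open scoped MatrixOrder in
/-- Two positive semidefinite matrices that are orthogonal for the trace pairing have product
zero. -/
theorem Matrix.PosSemidef.mul_eq_zero_of_trace_mul_eq_zero {A B : Matrix ι ι ℝ}
    (hA : A.PosSemidef) (hB : B.PosSemidef) (h : (A * B).trace = 0) : A * B = 0 := by
  classical
  obtain ⟨U, rfl⟩ := CStarAlgebra.nonneg_iff_eq_star_mul_self.mp hA.nonneg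
  obtain ⟨V, rfl⟩ := CStarAlgebra.nonneg_iff_eq_star_mul_self.mp hB.nonneg
  simp only [star_eq_conjTranspose] at h ⊢
  -- The trace of `Uᴴ U Vᴴ V` is the squared Frobenius norm of `V Uᴴ`.
  have hVU : V * Uᴴ = 0 := by
    rw [← trace_conjTranspose_mul_self_eq_zero_iff, conjTranspose_mul, conjTranspose_conjTranspose]
    rw [Matrix.mul_assoc, trace_mul_comm] at h
    simpa only [Matrix.mul_assoc] using h
  have hUV : U * Vᴴ = 0 := by simpa using congrArg (fun M : Matrix ι ι ℝ => Mᴴ) hVU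
  rw [Matrix.mul_assoc, ← Matrix.mul_assoc U, hUV]
  simp

/-- If `0 ⪯ Q ⪯ c I`, then `Q² ⪯ c² I`. -/
theorem posSemidef_sq_smul_one_sub_mul_self [DecidableEq ι] {Q : Matrix ι ι ℝ} {c : ℝ}
    (hc : 0 < c) (hQ : Q.PosSemidef) (hQc : (c • (1 : Matrix ι ι ℝ) - Q).PosSemidef) :
    (c ^ 2 • (1 : Matrix ι ι ℝ) - Q * Q).PosSemidef := by
  have hQh : Qᴴ = Q := hQ.1
  have hRh : (c • (1 : Matrix ι ι ℝ) - Q)ᴴ = c • (1 : Matrix ι ι ℝ) - Q := hQc.1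
  -- With `R = c I - Q`, which commutes with `Q`: `(R Q R + Q R Q) / c = Q R`, and `Q R + c R = c² I
  -- - Q²`.
  have h1 := hQ.conjTranspose_mul_mul_same (c • (1 : Matrix ι ι ℝ) - Q)
  have h2 := hQc.conjTranspose_mul_mul_same Q
  rw [hQh] at h2
  rw [hRh] at h1
  have h3 := ((h1.add h2).smul (inv_pos.2 hc).le).add (hQc.smul hc.le)
  convert h3 using 1
  simp only [Matrix.sub_mul, Matrix.mul_sub, Matrix.smul_mul, Matrix.mul_smul, Matrix.one_mul,
    Matrix.mul_one, smul_sub, smul_add, smul_smul, inv_mul_cancel₀ hc.ne', Matrix.mul_assoc]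
  rw [← mul_assoc, inv_mul_cancel₀ hc.ne']
  simp only [one_smul, one_mul, sq]
  abel

/-- Against a symmetric matrix, only the symmetric part of the coefficients of `φ` contributes. -/
theorem trace_symmetricRepr_mul [DecidableEq ι] (φ : Matrix ι ι ℝ →ₗ[ℝ] ℝ) {M : Matrix ι ι ℝ}
    (hM : M.IsSymm) : (symmetricRepr φ * M).trace = φ M := by
  have hφ : φ M = ∑ i, ∑ j, M i j * φ (single i j 1) := by
    conv_lhs => rw [matrix_eq_sum_single M]
    simp only [map_sum]
    refine Finset.sum_congr rfl fun i _ => Finset.sum_congr rfl fun j _ => ?_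
    rw [← smul_eq_mul, ← map_smul]
    simp
  have hφ' : φ M = ∑ i, ∑ j, M i j * φ (single j i 1) := by
    rw [hφ, Finset.sum_comm]
    refine Finset.sum_congr rfl fun i _ => Finset.sum_congr rfl fun j _ => ?_
    rw [hM.apply]
  have : (symmetricRepr φ * M).trace =
      ((∑ i, ∑ j, M i j * φ (single i j 1)) + ∑ i, ∑ j, M i j * φ (single j i 1)) / 2 := by
    simp only [trace, diag, mul_apply, symmetricRepr, of_apply, ← Finset.sum_add_distrib,
      Finset.sum_div]
    refine Finset.sum_congr rfl fun i _ => Finset.sum_congr rfl fun j _ => ?_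
    rw [hM.apply]
    ring
  rw [this, ← hφ, ← hφ']
  ring

/-- **Karush-Kuhn-Tucker theorem** for a linearized semidefinite program: if the constraint
`G + L q ⪯ 0` admits a strictly feasible direction and no strictly feasible direction decreases `c`,
then there is a multiplier. -/
theorem exists_multiplier {V : Type*} [AddCommGroup V] [Module ℝ V] (c : V →ₗ[ℝ] ℝ)
    (L : V →ₗ[ℝ] Matrix ι ι ℝ) {G : Matrix ι ι ℝ} (hG : NegSemidef G)
    (hL : ∀ q, (L q).IsSymm) {q₀ : V} (hq₀ : NegDef (G + L q₀))
    (hmin : ∀ d, NegDef (G + L d) → 0 ≤ c d) :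
    ∃ Λ : Matrix ι ι ℝ, Λ.PosSemidef ∧ (∀ q, c q + (Λ * L q).trace = 0) ∧ Λ * G = 0 := by
  classical
  -- Nonsymmetric matrices are admitted so that the cone is open in the full matrix space.
  set N : Set (Matrix ι ι ℝ) := {M | ∀ v : ι → ℝ, v ≠ 0 → v ⬝ᵥ M *ᵥ v < 0} with hN
  have hGs : G.IsSymm := (negSemidef_iff.1 hG).1
  have hNconv : Convex ℝ N := by
    intro M hM M' hM' a b ha hb hab v hv
    rw [add_mulVec, smul_mulVec, smul_mulVec, dotProduct_add, dotProduct_smul, dotProduct_smul,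
      smul_eq_mul, smul_eq_mul]
    have h1 := hM v hv
    have h2 := hM' v hv
    rcases ha.eq_or_lt with rfl | ha
    · have : b = 1 := by linarith
      subst this
      linarith
    · nlinarith [mul_neg_of_pos_of_neg ha h1, mul_nonpos_of_nonneg_of_nonpos hb h2.le]
  -- The hypothesis `hmin` says that this open cone misses the affine set of attainable pairs.
  obtain ⟨φ, u, hO, hA⟩ := geometric_hahn_banach_open (E := ℝ × Matrix ι ι ℝ)
    (s := Set.Iio (0 : ℝ) ×ˢ N) (t := Set.range fun d : V => (c d, G + L d))
    ((convex_Iio 0).prod hNconv) (isOpen_Iio.prod isOpen_setOf_quadraticForm_neg)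
    (by
      rintro _ ⟨d, rfl⟩ _ ⟨d', rfl⟩ a b ha hb hab
      refine ⟨a • d + b • d', ?_⟩
      ext1
      · simp
      · simp only [map_add, map_smul, Prod.smul_mk, Prod.mk_add_mk]
        rw [smul_add, smul_add, add_add_add_comm, ← add_smul, hab, one_smul])
    (by
      rw [Set.disjoint_left]
      rintro _ ⟨hx1, hx2⟩ ⟨d, rfl⟩
      exact absurd (hmin d (negDef_iff.2 ⟨hGs.add (hL d), hx2⟩)) (not_le.2 hx1))
  replace hA : ∀ d, u ≤ φ (c d, G + L d) := fun d => hA _ ⟨d, rfl⟩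
  have hφ : ∀ (t : ℝ) (M : Matrix ι ι ℝ), φ (t, M) = t * φ (1, 0) + φ (0, M) := by
    intro t M
    rw [← smul_eq_mul, ← map_smul, ← map_add]
    simp
  set l₀ : ℝ := φ (1, 0) with hl₀
  set ψ : Matrix ι ι ℝ →ₗ[ℝ] ℝ := φ.toLinearMap ∘ₗ LinearMap.inr ℝ ℝ (Matrix ι ι ℝ) with hψdef
  have hψ : ∀ M, φ (0, M) = ψ M := fun M => rfl
  replace hA : ∀ d, u ≤ c d * l₀ + ψ (G + L d) := fun d => by
    rw [← hψ, ← hφ]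
    exact hA d
  replace hO : ∀ t < 0, ∀ M ∈ N, t * l₀ + ψ M < u := fun t ht M hM => by
    rw [← hψ, ← hφ]
    exact hO (t, M) ⟨ht, hM⟩
  -- the open set is a cone, hence the separating level is nonnegative
  have hone : -(1 : Matrix ι ι ℝ) ∈ N := fun v hv => by
    have := (PosDef.one (n := ι) (R := ℝ)).dotProduct_mulVec_pos hv
    simpa [neg_mulVec] using this
  have hNadd : ∀ M : Matrix ι ι ℝ, (∀ v : ι → ℝ, v ⬝ᵥ M *ᵥ v ≤ 0) → ∀ s > (0 : ℝ), ∀ M' ∈ N,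
      M + s • M' ∈ N := fun M hM s hs M' hM' v hv => by
    rw [add_mulVec, smul_mulVec, dotProduct_add, dotProduct_smul, smul_eq_mul]
    have := mul_neg_of_pos_of_neg hs (hM' v hv)
    linarith [hM v]
  have hlim : ∀ t ≤ 0, ∀ M : Matrix ι ι ℝ, (∀ v : ι → ℝ, v ⬝ᵥ M *ᵥ v ≤ 0) →
      t * l₀ + ψ M ≤ u := by
    intro t ht M hM
    have hten : Tendsto (fun s : ℝ => (t - s) * l₀ + ψ (M + s • -(1 : Matrix ι ι ℝ)))
        (𝓝[>] 0) (𝓝 (t * l₀ + ψ M)) := by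
      have : Continuous fun s : ℝ => (t - s) * l₀ + (ψ M + s * ψ (-1)) := by fun_prop
      have := (this.tendsto 0).mono_left (nhdsWithin_le_nhds (s := Set.Ioi (0 : ℝ)))
      simpa using this
    refine le_of_tendsto hten ?_
    filter_upwards [self_mem_nhdsWithin] with s hs
    have hs : 0 < s := hs
    exact (hO _ (by linarith) _ (hNadd M hM s hs _ hone)).le
  -- A positive value on the closed cone would exceed `u` after scaling.
  have hcone : ∀ t ≤ 0, ∀ M : Matrix ι ι ℝ, (∀ v : ι → ℝ, v ⬝ᵥ M *ᵥ v ≤ 0) →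
      t * l₀ + ψ M ≤ 0 := by
    intro t ht M hM
    by_contra! hcon
    obtain ⟨n, hn⟩ := exists_nat_gt (u / (t * l₀ + ψ M))
    rw [div_lt_iff₀ hcon] at hn
    have hn0 : (0 : ℝ) ≤ n := n.cast_nonneg
    have := hlim (n * t) (mul_nonpos_of_nonneg_of_nonpos hn0 ht) ((n : ℝ) • M) fun v => by
      rw [smul_mulVec, dotProduct_smul, smul_eq_mul]
      exact mul_nonpos_of_nonneg_of_nonpos hn0 (hM v)
    rw [map_smul, smul_eq_mul] at this
    nlinarith
  have hu : 0 ≤ u := by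
    have := hlim 0 le_rfl 0 (by simp)
    simpa using this
  have hGle : ψ G ≤ 0 := by simpa using hcone 0 le_rfl G (negSemidef_iff.1 hG).2
  have hG0 : ψ G = 0 := by
    have := hA 0
    simp only [map_zero, zero_mul, add_zero, zero_add] at this
    linarith
  have hu0 : u = 0 := by
    have := hA 0
    simp only [map_zero, zero_mul, add_zero, zero_add] at this
    linarith
  subst hu0
  -- A linear functional that is nonnegative at both `q` and `-q` vanishes.
  have hstat : ∀ q, c q * l₀ + ψ (L q) = 0 := by
    intro q
    have h1 := hA q
    have h2 := hA (-q)
    simp only [map_add, map_neg, hG0] at h1 h2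
    linarith
  have hl₀nonneg : 0 ≤ l₀ := by
    have := hcone (-1) (by norm_num) 0 (by simp)
    simp at this
    exact this
  -- This is where strict feasibility enters: if `l₀ = 0`, then `ψ (G + L q₀)` would be both zero
  -- and negative.
  have hl₀pos : 0 < l₀ := by
    refine hl₀nonneg.lt_of_ne' fun h0 => ?_
    have h1 := hO (-1) (by norm_num) _ (negDef_iff.1 hq₀).2
    have h2 := hstat q₀
    rw [map_add, hG0, h0] at h1
    rw [h0] at h2
    linarith
  have hpsd : (symmetricRepr ψ).PosSemidef := by
    refine .of_dotProduct_mulVec_nonneg ?_ fun v => ?_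
    · rw [IsHermitian, conjTranspose_eq_transpose_of_trivial]
      exact isSymm_symmetricRepr ψ
    -- Testing `ψ` on `-v vᵀ` reads off the quadratic form of its representing matrix.
    · have h1 := hcone 0 le_rfl (-vecMulVec v v) fun w => by
        rw [neg_mulVec, dotProduct_neg, vecMulVec_mulVec]
        simp only [op_smul_eq_smul, dotProduct_smul, smul_eq_mul, dotProduct_comm w v]
        nlinarith [sq_nonneg (v ⬝ᵥ w)]
      rw [map_neg, zero_mul, zero_add, ← trace_symmetricRepr_mul ψ (transpose_vecMulVec v v),
        mul_vecMulVec, trace_vecMulVec, dotProduct_comm] at h1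
      simpa using h1
  refine ⟨l₀⁻¹ • symmetricRepr ψ, ?_, fun q => ?_, ?_⟩
  · exact hpsd.smul (inv_nonneg.2 hl₀nonneg)
  · rw [smul_mul, trace_smul, trace_symmetricRepr_mul ψ (hL q), smul_eq_mul]
    have := hstat q
    field_simp
    linarith
  · rw [smul_mul]
    have := hpsd.mul_eq_zero_of_trace_mul_eq_zero hG (by
      rw [Matrix.mul_neg, trace_neg, trace_symmetricRepr_mul ψ hGs, hG0, neg_zero])
    rw [Matrix.mul_neg, neg_eq_zero] at this
    rw [this, smul_zero]

end MatrixLemmas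

/-! ### Coordinates and the proximal term -/

namespace Vars

variable {nx N : ℕ} {nu : Fin N → ℕ}

theorem S_add (p q : Vars nx nu) : (p + q).S = p.S + q.S := rfl
theorem zeta_add (p q : Vars nx nu) : (p + q).zeta = p.zeta + q.zeta := rfl
theorem Z_add (p q : Vars nx nu) : (p + q).Z = p.Z + q.Z := rfl
theorem sel_add (p q : Vars nx nu) : (p + q).sel = p.sel + q.sel := rfl
theorem S_smul (t : ℝ) (q : Vars nx nu) : (t • q).S = t • q.S := rfl
theorem zeta_smul (t : ℝ) (q : Vars nx nu) : (t • q).zeta = t * q.zeta := rfl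
theorem Z_smul (t : ℝ) (q : Vars nx nu) : (t • q).Z = t • q.Z := rfl
theorem sel_smul (t : ℝ) (q : Vars nx nu) : (t • q).sel = t • q.sel := rfl

theorem selMat_add (p q : Vars nx nu) : (p + q).selMat = p.selMat + q.selMat := by
  simp [selMat, diagonal_add, sel_add]

theorem selMat_smul (t : ℝ) (q : Vars nx nu) : (t • q).selMat = t • q.selMat := by
  rw [selMat, selMat, ← diagonal_smul]
  rfl

theorem transpose_S (p : Vars nx nu) : p.Sᵀ = p.S := p.1.2

theorem transpose_selMat (p : Vars nx nu) : p.selMatᵀ = p.selMat := diagonal_transpose _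

theorem continuous_S : Continuous (S : Vars nx nu → _) :=
  continuous_subtype_val.comp continuous_fst

theorem continuous_zeta : Continuous (zeta : Vars nx nu → _) :=
  continuous_fst.comp continuous_snd

theorem continuous_Z : Continuous (Z : Vars nx nu → _) :=
  continuous_fst.comp (continuous_snd.comp continuous_snd)

theorem continuous_sel : Continuous (sel : Vars nx nu → _) :=
  continuous_snd.comp (continuous_snd.comp continuous_snd)

theorem continuous_selMat : Continuous (selMat : Vars nx nu → _) :=
  Continuous.matrix_diagonal (continuous_pi fun a => (continuous_apply a.1).comp continuous_sel)

theorem continuous_frobSq {ι κ : Type*} [Fintype ι] [Fintype κ] :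
    Continuous (frobSq : Matrix ι κ ℝ → ℝ) := by
  unfold frobSq
  fun_prop

theorem continuous_prox (p : Vars nx nu) : Continuous fun p' => p.prox p' := by
  have h1 := continuous_S (nx := nx) (nu := nu)
  have h2 := continuous_Z (nx := nx) (nu := nu)
  have h3 := continuous_zeta (nx := nx) (nu := nu)
  have h4 := continuous_selMat (nx := nx) (nu := nu)
  exact (((continuous_const.sub h3).pow 2).add
    (continuous_frobSq.comp (continuous_const.sub h1))).add
    (continuous_frobSq.comp (continuous_const.sub h2)) |>.add
    (continuous_frobSq.comp (continuous_const.sub h4))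

theorem frobSq_nonneg {ι κ : Type*} [Fintype ι] [Fintype κ] (M : Matrix ι κ ℝ) :
    0 ≤ frobSq M :=
  Finset.sum_nonneg fun _ _ => Finset.sum_nonneg fun _ _ => sq_nonneg _

theorem frobSq_smul {ι κ : Type*} [Fintype ι] [Fintype κ] (t : ℝ) (M : Matrix ι κ ℝ) :
    frobSq (t • M) = t ^ 2 * frobSq M := by
  simp [frobSq, Finset.mul_sum, mul_pow]

theorem prox_nonneg (p p' : Vars nx nu) : 0 ≤ p.prox p' := by
  have h1 := frobSq_nonneg (p.S - p'.S)
  have h2 := frobSq_nonneg (p.Z - p'.Z)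
  have h3 := frobSq_nonneg (p.selMat - p'.selMat)
  unfold prox
  positivity

theorem prox_self (p : Vars nx nu) : p.prox p = 0 := by
  simp [prox, frobSq]

/-- Being of order `t²`, the proximal cost is eventually dominated by a linear decrease of `f`. -/
theorem prox_add_smul (p q : Vars nx nu) (t : ℝ) :
    (p + t • q).prox p = t ^ 2 * (q.zeta ^ 2 + frobSq q.S + frobSq q.Z + frobSq q.selMat) := by
  simp only [prox, S_add, zeta_add, Z_add, selMat_add, S_smul, zeta_smul, Z_smul, selMat_smul,
    add_sub_cancel_left, frobSq_smul]
  ring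

end Vars

/-! ### Exact expansion and differential of the constraint -/

namespace SelData

open Vars

variable {nx nw nz m N : ℕ} {nu : Fin N → ℕ}

theorem f_add_smul (D : SelData nx nw nz m nu) (p q : Vars nx nu) (t : ℝ) :
    D.f (p + t • q) = D.f p + t * D.f q := by
  simp only [f, zeta_add, zeta_smul, sel_add, sel_smul, dotProduct_add, dotProduct_smul,
    smul_eq_mul]
  ring

/-- The objective as a linear functional. -/
def fLin (D : SelData nx nw nz m nu) : Vars nx nu →ₗ[ℝ] ℝ where
  toFun := D.f
  map_add' p q := by simpa using D.f_add_smul p q 1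
  map_smul' t q := by
    have h0 : D.f 0 = 0 := by simpa using D.f_add_smul 0 0 1
    simpa [h0] using D.f_add_smul 0 q t

theorem continuous_f (D : SelData nx nw nz m nu) : Continuous D.f := by
  have h3 := continuous_zeta (nx := nx) (nu := nu)
  have h4 := continuous_sel (nx := nx) (nu := nu)
  exact (continuous_const.mul h3).add (continuous_const.dotProduct h4)

theorem continuous_F1 (D : SelData nx nw nz m nu) : Continuous D.F1 := by
  have h1 := continuous_S (nx := nx) (nu := nu)
  have h2 := continuous_Z (nx := nx) (nu := nu)
  have h4 := continuous_selMat (nx := nx) (nu := nu)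
  unfold F1
  fun_prop

theorem continuous_F2 (D : SelData nx nw nz m nu) : Continuous D.F2 := by
  have h1 := continuous_S (nx := nx) (nu := nu)
  have h3 := continuous_zeta (nx := nx) (nu := nu)
  refine Continuous.matrix_fromBlocks (by fun_prop) ?_ ?_ (by fun_prop)
  · refine continuous_matrix fun i j => ?_
    rcases i with i | i
    · exact Continuous.matrix_elem (A := fun p : Vars nx nu => p.S * D.Czᵀ) (by fun_prop) i j
    · exact continuous_const
  · refine continuous_matrix fun i j => ?_
    rcases j with j | j
    · exact Continuous.matrix_elem (A := fun p : Vars nx nu => D.Cz * p.S) (by fun_prop) i j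
    · exact continuous_const

theorem negSemidef_G (D : SelData nx nw nz m nu) {p : Vars nx nu} :
    NegSemidef (D.G p) ↔ NegSemidef (D.F1 p) ∧ NegSemidef (D.F2 p) ∧ D.H *ᵥ p.sel ≤ D.h ∧
      0 ≤ p.sel ∧ p.sel ≤ 1 := by
  simp only [G, negSemidef_fromBlocks_zero, negSemidef_diagonal, sub_nonpos, neg_nonpos]

/-- The linear part of the differential of `F1`. -/
def dF1 (D : SelData nx nw nz m nu) (p q : Vars nx nu) :
    Matrix (Fin nx ⊕ Fin nw) (Fin nx ⊕ Fin nw) ℝ :=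
  fromBlocks
    (D.A * q.S + q.S * D.Aᵀ + D.alpha • q.S
      - (D.Bu * q.selMat * p.Z + D.Bu * p.selMat * q.Z)
      - (p.Zᵀ * q.selMat * D.Buᵀ + q.Zᵀ * p.selMat * D.Buᵀ)) 0 0 0

/-- The differential of `F2`. -/
def dF2 (D : SelData nx nw nz m nu) (q : Vars nx nu) :
    Matrix ((Fin nx ⊕ Fin nw) ⊕ Fin nz) ((Fin nx ⊕ Fin nw) ⊕ Fin nz) ℝ :=
  fromBlocks (fromBlocks (-q.S) 0 0 0) (fromRows (q.S * D.Czᵀ) 0) (fromCols (D.Cz * q.S) 0)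
    (-(q.zeta • (1 : Matrix (Fin nz) (Fin nz) ℝ)))

/-- The quadratic part of `F1`. -/
def quadF1 (D : SelData nx nw nz m nu) (q : Vars nx nu) :
    Matrix (Fin nx ⊕ Fin nw) (Fin nx ⊕ Fin nw) ℝ :=
  fromBlocks (-(D.Bu * q.selMat * q.Z) - q.Zᵀ * q.selMat * D.Buᵀ) 0 0 0

theorem dF1_add (D : SelData nx nw nz m nu) (p q q' : Vars nx nu) :
    D.dF1 p (q + q') = D.dF1 p q + D.dF1 p q' := by
  simp only [dF1, fromBlocks_add, S_add, Z_add, selMat_add, add_zero, fromBlocks_inj, and_true]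
  simp only [transpose_add, Matrix.mul_add, Matrix.add_mul]
  module

theorem dF1_smul (D : SelData nx nw nz m nu) (p q : Vars nx nu) (t : ℝ) :
    D.dF1 p (t • q) = t • D.dF1 p q := by
  simp only [dF1, fromBlocks_smul, S_smul, Z_smul, selMat_smul, smul_zero, fromBlocks_inj,
    and_true]
  simp only [transpose_smul, Matrix.mul_smul, Matrix.smul_mul]
  module

theorem dF2_add (D : SelData nx nw nz m nu) (q q' : Vars nx nu) :
    D.dF2 (q + q') = D.dF2 q + D.dF2 q' := by
  ext ((i | i) | i) ((j | j) | j) <;>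
    simp [dF2, S_add, zeta_add, Matrix.mul_add, Matrix.add_mul, add_mul] <;> ring

theorem dF2_smul (D : SelData nx nw nz m nu) (q : Vars nx nu) (t : ℝ) :
    D.dF2 (t • q) = t • D.dF2 q := by
  ext ((i | i) | i) ((j | j) | j) <;> simp [dF2, S_smul, zeta_smul]
  ring

/-- The differential of `G`, as a linear map. -/
def dG (D : SelData nx nw nz m nu) (p : Vars nx nu) :
    Vars nx nu →ₗ[ℝ] Matrix (ConIdx nx nw nz m N) (ConIdx nx nw nz m N) ℝ where
  toFun q := fromBlocks (D.dF1 p q) 0 0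
    (fromBlocks (D.dF2 q) 0 0
      (fromBlocks (diagonal (D.H *ᵥ q.sel)) 0 0
        (fromBlocks (diagonal (-q.sel)) 0 0 (diagonal q.sel))))
  map_add' q q' := by
    simp only [dF1_add, dF2_add, fromBlocks_add, add_zero, sel_add, mulVec_add, neg_add,
      diagonal_add]
    rfl
  map_smul' t q := by
    simp only [dF1_smul, dF2_smul, fromBlocks_smul, smul_zero, sel_smul, mulVec_smul, ← smul_neg,
      diagonal_smul, RingHom.id_apply]

theorem F1_add_smul (D : SelData nx nw nz m nu) (p q : Vars nx nu) (t : ℝ) :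
    D.F1 (p + t • q) = D.F1 p + t • D.dF1 p q + t ^ 2 • D.quadF1 q := by
  simp only [F1, dF1, quadF1, fromBlocks_smul, fromBlocks_add, S_add, Z_add, selMat_add, S_smul,
    Z_smul, selMat_smul, smul_zero, add_zero, fromBlocks_inj, and_true]
  simp only [transpose_add, transpose_smul, Matrix.mul_add, Matrix.add_mul, Matrix.mul_smul,
    Matrix.smul_mul]
  module

theorem F2_add_smul (D : SelData nx nw nz m nu) (p q : Vars nx nu) (t : ℝ) :
    D.F2 (p + t • q) = D.F2 p + t • D.dF2 q := by
  ext (( i | i) | i) ((j | j) | j) <;>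
    simp [F2, dF2, S_add, zeta_add, S_smul, zeta_smul, Matrix.mul_add, Matrix.add_mul, add_mul] <;>
    ring

/-- The only nonlinearity is the product of `selMat` and `Z`, so the expansion stops at order two
and its remainder sits in the `F1` block. -/
theorem G_add_smul (D : SelData nx nw nz m nu) (p q : Vars nx nu) (t : ℝ) :
    D.G (p + t • q) = D.G p + t • D.dG p q + t ^ 2 • fromBlocks (D.quadF1 q) 0 0 0 := by
  simp only [G, dG, LinearMap.coe_mk, AddHom.coe_mk, fromBlocks_smul, fromBlocks_add, F1_add_smul,
    F2_add_smul, smul_zero, add_zero, fromBlocks_inj, true_and, ← diagonal_smul,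
    diagonal_add, sel_add, sel_smul, mulVec_add, mulVec_smul]
  refine ⟨?_, ?_, ?_⟩ <;> congr 1 <;> ext i <;> simp <;> ring

theorem hasLineDerivAt_G (D : SelData nx nw nz m nu) (p q : Vars nx nu)
    (i j : ConIdx nx nw nz m N) :
    HasLineDerivAt ℝ (fun p' => D.G p' i j) (D.dG p q i j) p q := by
  unfold HasLineDerivAt
  simp only [G_add_smul, Matrix.add_apply, Matrix.smul_apply, smul_eq_mul]
  have h := (((hasDerivAt_id (0 : ℝ)).mul_const (D.dG p q i j)).const_add (D.G p i j)).fun_add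
    (((hasDerivAt_id (0 : ℝ)).pow 2).mul_const ((fromBlocks (D.quadF1 q) 0 0 0 :
      Matrix (ConIdx nx nw nz m N) (ConIdx nx nw nz m N) ℝ) i j))
  simpa using h

theorem DG_eq_dG (D : SelData nx nw nz m nu) (p q : Vars nx nu) : D.DG p q = D.dG p q := by
  ext i j
  exact (D.hasLineDerivAt_G p q i j).lineDeriv

theorem hasLineDerivAt_lagrangian (D : SelData nx nw nz m nu) (p q : Vars nx nu)
    (Lam : Matrix (ConIdx nx nw nz m N) (ConIdx nx nw nz m N) ℝ) :
    HasLineDerivAt ℝ (fun p' => D.lagrangian p' Lam) (D.f q + (Lam * D.dG p q).trace) p q := by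
  unfold HasLineDerivAt lagrangian
  simp only [G_add_smul, f_add_smul, Matrix.mul_add, Matrix.mul_smul, trace_add, trace_smul,
    smul_eq_mul]
  have h := (((hasDerivAt_id (0 : ℝ)).mul_const (D.f q)).const_add (D.f p)).fun_add
    ((((hasDerivAt_id (0 : ℝ)).mul_const ((Lam * D.dG p q).trace)).const_add
      ((Lam * D.G p).trace)).fun_add
    (((hasDerivAt_id (0 : ℝ)).pow 2).mul_const ((Lam * (fromBlocks (D.quadF1 q) 0 0 0 :
      Matrix (ConIdx nx nw nz m N) (ConIdx nx nw nz m N) ℝ)).trace)))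
  simpa using h

theorem isSymm_dG (D : SelData nx nw nz m nu) (p q : Vars nx nu) : (D.dG p q).IsSymm := by
  simp only [IsSymm, dG, dF1, dF2, LinearMap.coe_mk, AddHom.coe_mk, fromBlocks_transpose,
    diagonal_transpose, transpose_zero, transpose_fromRows, transpose_fromCols, fromBlocks_inj,
    transpose_neg, transpose_smul, transpose_one, transpose_mul, transpose_transpose,
    transpose_add, transpose_sub, transpose_S, transpose_selMat, and_true,
    Matrix.mul_assoc]
  abel

end SelData

/-! ### The surrogate constraint -/

namespace SelData

open Vars

variable {nx nw nz m N : ℕ} {nu : Fin N → ℕ}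

theorem isSymm_F1 (D : SelData nx nw nz m nu) (p : Vars nx nu) : (D.F1 p).IsSymm := by
  simp only [IsSymm, F1, fromBlocks_transpose, fromBlocks_inj, transpose_neg, transpose_smul,
    transpose_one, transpose_mul, transpose_transpose, transpose_add, transpose_sub, transpose_S,
    transpose_selMat, and_true, Matrix.mul_assoc]
  abel

theorem isSymm_F2 (D : SelData nx nw nz m nu) (p : Vars nx nu) : (D.F2 p).IsSymm := by
  simp only [IsSymm, F2, fromBlocks_transpose, transpose_neg, transpose_smul, transpose_zero,
    transpose_one, transpose_mul, transpose_transpose, transpose_S, transpose_fromRows,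
    transpose_fromCols]

theorem isClosed_feasible (D : SelData nx nw nz m nu) : IsClosed D.feasible := by
  have h4 := continuous_sel (nx := nx) (nu := nu)
  have hF1 := D.continuous_F1
  have hF2 := D.continuous_F2
  have : D.feasible = {p | ∀ v, v ⬝ᵥ D.F1 p *ᵥ v ≤ 0} ∩ {p | ∀ v, v ⬝ᵥ D.F2 p *ᵥ v ≤ 0} ∩
      {p | D.H *ᵥ p.sel ≤ D.h} ∩ {p | 0 ≤ p.sel} ∩ {p | p.sel ≤ 1} := by
    ext p
    have h : p ∈ D.feasible ↔ NegSemidef (D.G p) := Iff.rfl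
    rw [h, negSemidef_G, negSemidef_iff, negSemidef_iff]
    simp only [isSymm_F1, isSymm_F2, true_and, Set.mem_inter_iff, Set.mem_ofPred_eq, and_assoc]
  rw [this]
  refine ((((?_ : IsClosed _).inter ?_).inter ?_).inter ?_).inter ?_
  · simp only [Set.ofPred_forall]
    exact isClosed_iInter fun v => isClosed_le (by fun_prop) continuous_const
  · simp only [Set.ofPred_forall]
    exact isClosed_iInter fun v => isClosed_le (by fun_prop) continuous_const
  · exact isClosed_le (by fun_prop) continuous_const
  · exact isClosed_le continuous_const h4
  · exact isClosed_le h4 continuous_const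

/-- The congruence that turns the surrogate constraint into the bilinear constraint. -/
def elim (D : SelData nx nw nz m nu) (p p' : Vars nx nu) :
    Matrix ((Fin nx ⊕ Fin nw) ⊕ (InputIdx nu ⊕ InputIdx nu)) (Fin nx ⊕ Fin nw) ℝ :=
  fromRows 1 (fromBlocks (D.Bu * (p.selMat - p'.selMat))ᵀ 0
    (-(D.Bu * (p.selMat - p'.selMat))ᵀ) 0)

/-- Write `X = Bu ΔΠ`. The diagonal blocks contribute `-2 X Q' Xᵀ`, which cancels the `Q'` cross
terms; the `ΔZ` cross terms supply the missing `-X ΔZ - ΔZᵀ Xᵀ`. -/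
theorem transpose_elim_mul_Ks_mul_elim (D : SelData nx nw nz m nu) (p p' : Vars nx nu)
    (Q Q' : Matrix (InputIdx nu) (InputIdx nu) ℝ) :
    (D.elim p p')ᵀ * D.Ks p Q p' Q' * D.elim p p' = D.F1 p := by
  simp only [elim, Ks, transpose_fromRows, fromBlocks_mul_fromRows, fromCols_mul_fromRows,
    fromBlocks_transpose, transpose_neg, transpose_transpose, transpose_zero, transpose_one,
    Matrix.mul_assoc, Matrix.one_mul, Matrix.mul_one, fromBlocks_multiply, fromBlocks_add,
    Matrix.mul_zero, Matrix.zero_mul, add_zero, F1, fromBlocks_inj, and_true]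
  simp only [Omega, transpose_mul, transpose_sub, transpose_selMat]
  simp only [Matrix.mul_add, Matrix.add_mul, Matrix.mul_sub, Matrix.sub_mul, Matrix.mul_neg,
    Matrix.neg_mul, Matrix.mul_smul, Matrix.smul_mul, Matrix.mul_assoc, Matrix.mul_zero]
  module

theorem SubFeasible.mem_feasible {D : SelData nx nw nz m nu} {c₁ c₂ c₃ : ℝ} {p p' : Vars nx nu}
    {Q Q' : Matrix (InputIdx nu) (InputIdx nu) ℝ} (h : D.SubFeasible c₁ c₂ c₃ p' Q' p Q) :
    p ∈ D.feasible := by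
  refine D.negSemidef_G.2 ⟨?_, h.lmi, h.coupling, h.box_lower, h.box_upper⟩
  have := PosSemidef.conjTranspose_mul_mul_same h.surrogate (D.elim p p')
  rwa [conjTranspose_eq_transpose_of_trivial, Matrix.mul_neg, Matrix.neg_mul,
    transpose_elim_mul_Ks_mul_elim] at this

theorem Ks_self (D : SelData nx nw nz m nu) (p : Vars nx nu)
    (Q Q' : Matrix (InputIdx nu) (InputIdx nu) ℝ) :
    D.Ks p Q p Q' =
      fromBlocks (D.F1 p) 0 0 (fromBlocks (-((2 : ℝ) • Q') + Q) 0 0 (-Q)) := by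
  simp only [Ks, F1, Omega, sub_self, Matrix.mul_zero, Matrix.zero_mul, transpose_zero,
    fromBlocks_zero, fromBlocks_inj, and_true, sub_zero]
  abel

/-- The scalar conditions on `Q` are shared by all points, so a feasible current point stays
feasible for the subproblem built at it. -/
theorem SubFeasible.self {D : SelData nx nw nz m nu} {c₁ c₂ c₃ : ℝ} (hc₁ : 0 ≤ c₁) (hc₃ : 0 ≤ c₃)
    {p p' : Vars nx nu} {Q Q' : Matrix (InputIdx nu) (InputIdx nu) ℝ}
    (h : D.SubFeasible c₁ c₂ c₃ p' Q' p Q) (hp' : p' ∈ D.feasible) :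
    D.SubFeasible c₁ c₂ c₃ p' Q' p' Q := by
  obtain ⟨h1, h2, h3, h4, h5⟩ := D.negSemidef_G.1 hp'
  refine ⟨h.symm, ?_, h.lower, h.upper, h.gap, h2, h3, h4, h5⟩
  rw [Ks_self, negSemidef_fromBlocks_zero, negSemidef_fromBlocks_zero]
  refine ⟨h1, ?_, ?_⟩
  · have := PosSemidef.add h.gap (PosSemidef.one.smul hc₃)
    rw [NegSemidef]
    convert this using 1
    abel
  · rw [NegSemidef, neg_neg]
    simpa using h.lower.add (PosSemidef.one.smul hc₁)

/-- A sufficient condition for the surrogate constraint that does not involve `Q`. -/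
def margin (D : SelData nx nw nz m nu) (a b : ℝ) (p p' : Vars nx nu) :
    Matrix (Fin nx ⊕ Fin nw) (Fin nx ⊕ Fin nw) ℝ :=
  fromBlocks (D.Omega p p' +
      (a • ((D.Bu * (p.selMat - p'.selMat)) * (D.Bu * (p.selMat - p'.selMat))ᵀ) +
        b • ((p.Z - p'.Z)ᵀ * (p.Z - p'.Z))))
    D.Bw D.Bwᵀ (-((D.alpha * D.eta) • (1 : Matrix (Fin nw) (Fin nw) ℝ)))

theorem isSymm_margin (D : SelData nx nw nz m nu) (a b : ℝ) (p p' : Vars nx nu) :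
    (D.margin a b p p').IsSymm := by
  simp only [IsSymm, margin, Omega, fromBlocks_transpose, fromBlocks_inj, transpose_neg,
    transpose_smul, transpose_one, transpose_mul, transpose_transpose, transpose_add,
    transpose_sub, transpose_S, transpose_selMat, and_true, Matrix.mul_assoc]
  abel

theorem continuous_margin (D : SelData nx nw nz m nu) (a b : ℝ) (p : Vars nx nu) :
    Continuous (D.margin a b p) := by
  have h1 := continuous_S (nx := nx) (nu := nu)
  have h2 := continuous_Z (nx := nx) (nu := nu)
  have h4 := continuous_selMat (nx := nx) (nu := nu)
  unfold margin Omega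
  fun_prop

/-- `Omega` is the linearization of the bilinear block, so the penalty for removing `Q` appears only
at order `t²`. -/
theorem margin_add_smul (D : SelData nx nw nz m nu) (a b : ℝ) (p q : Vars nx nu) (t : ℝ) :
    D.margin a b (p + t • q) p = D.F1 p + t • D.dF1 p q +
      t ^ 2 • fromBlocks (a • ((D.Bu * q.selMat) * (D.Bu * q.selMat)ᵀ) + b • (q.Zᵀ * q.Z))
        0 0 0 := by
  simp only [margin, Omega, F1, dF1, fromBlocks_smul, fromBlocks_add, S_add, Z_add, selMat_add,
    S_smul, Z_smul, selMat_smul, smul_zero, add_zero, add_sub_cancel_left, fromBlocks_inj,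
    and_true]
  simp only [transpose_smul, transpose_mul, Matrix.mul_add, Matrix.add_mul, Matrix.mul_smul,
    Matrix.smul_mul]
  module

/-- A Schur complement bound without inverses: `c₁⁻¹` stands in for `Q⁻¹`, and `c₃⁻¹ c₂²` for `Q' (2
Q' - Q)⁻¹ Q'`. The negated surrogate is a block diagonal positive semidefinite matrix plus the Gram
terms `c₃⁻¹ V Vᵀ` and `c₁⁻¹ W Wᵀ`. -/
theorem negSemidef_Ks_of_margin (D : SelData nx nw nz m nu) {c₁ c₂ c₃ : ℝ} (hc₁ : 0 < c₁)
    (hc₂ : 0 < c₂) (hc₃ : 0 < c₃) {p p' : Vars nx nu}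
    {Q Q' : Matrix (InputIdx nu) (InputIdx nu) ℝ} (hQ'symm : Q'ᵀ = Q')
    (hQ' : Q'.PosSemidef)
    (hQ'c : (c₂ • (1 : Matrix (InputIdx nu) (InputIdx nu) ℝ) - Q').PosSemidef)
    (hQ : (Q - c₁ • (1 : Matrix (InputIdx nu) (InputIdx nu) ℝ)).PosSemidef)
    (hgap : NegSemidef
      ((-((2 : ℝ) • Q') + Q) + c₃ • (1 : Matrix (InputIdx nu) (InputIdx nu) ℝ)))
    (hmargin : NegSemidef (D.margin (c₃⁻¹ * c₂ ^ 2) c₁⁻¹ p p')) :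
    NegSemidef (D.Ks p Q p' Q') := by
  set X := D.Bu * (p.selMat - p'.selMat) with hX
  set Y := p.Z - p'.Z with hY
  have hXt : (p.selMat - p'.selMat) * D.Buᵀ = Xᵀ := by
    rw [hX, transpose_mul, transpose_sub, transpose_selMat, transpose_selMat]
  -- complete the squares in the two lower blocks
  set V : Matrix ((Fin nx ⊕ Fin nw) ⊕ (InputIdx nu ⊕ InputIdx nu)) (InputIdx nu) ℝ :=
    fromRows (fromRows (X * Q') 0) (fromRows (-(c₃ • 1)) 0) with hV
  set W : Matrix ((Fin nx ⊕ Fin nw) ⊕ (InputIdx nu ⊕ InputIdx nu)) (InputIdx nu) ℝ :=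
    fromRows (fromRows Yᵀ 0) (fromRows 0 (-(c₁ • 1))) with hW
  have hVV := (posSemidef_self_mul_conjTranspose V).smul (inv_pos.2 hc₃).le
  have hWW := (posSemidef_self_mul_conjTranspose W).smul (inv_pos.2 hc₁).le
  have hsq := ((posSemidef_sq_smul_one_sub_mul_self hc₂ hQ' hQ'c).mul_mul_conjTranspose_same
    X).smul (inv_pos.2 hc₃).le
  have hdiag := posSemidef_fromBlocks_zero.2 ⟨PosSemidef.add hmargin
      (posSemidef_fromBlocks_zero.2 ⟨hsq, PosSemidef.zero⟩),
    posSemidef_fromBlocks_zero.2 ⟨hgap, hQ⟩⟩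
  have hsum := (hdiag.add hVV).add hWW
  rw [NegSemidef]
  convert hsum using 1
  simp only [Ks, margin, hV, hW, conjTranspose_eq_transpose_of_trivial, transpose_fromRows,
    fromRows_mul_fromCols, fromBlocks_neg, fromBlocks_smul,
    fromBlocks_add, transpose_zero, transpose_neg, transpose_smul, transpose_one, Matrix.mul_zero,
    Matrix.zero_mul, smul_zero, add_zero, zero_add, transpose_mul, transpose_transpose, hQ'symm]
  rw [← hX, ← hY, Matrix.mul_assoc Q' _ D.Buᵀ, hXt]
  have hXt' : (p.selMat - p'.selMat)ᵀ * D.Buᵀ = Xᵀ := by rw [hX, transpose_mul]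
  simp only [hXt', Matrix.mul_assoc, fromBlocks_inj, neg_zero, and_true, true_and,
    Matrix.mul_neg, Matrix.neg_mul, Matrix.mul_smul, Matrix.smul_mul, Matrix.mul_one,
    Matrix.one_mul, Matrix.mul_sub, Matrix.sub_mul, smul_neg, smul_smul, inv_mul_cancel₀ hc₁.ne',
    inv_mul_cancel₀ hc₃.ne', inv_mul_cancel_left₀ hc₁.ne',
    inv_mul_cancel_left₀ hc₃.ne', one_smul, neg_neg]
  refine ⟨?_, ?_, ?_⟩ <;> module

end SelData

/-! ### Descent directions and convergence -/

namespace SelData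

open Vars

variable {nx nw nz m N : ℕ} {nu : Fin N → ℕ}

/-- Under MFCQ, a feasible point that is not stationary has a strictly feasible descent
direction of the linearized problem. -/
theorem exists_descent_direction (D : SelData nx nw nz m nu) {r : Vars nx nu}
    (hr : r ∈ D.feasible) (hM : D.MFCQ r) (hns : ¬ D.IsStationary r) :
    ∃ d, NegDef (D.G r + D.dG r d) ∧ D.f d < 0 := by
  by_contra! hcon
  obtain ⟨q₀, hq₀⟩ := hM
  rw [DG_eq_dG] at hq₀
  obtain ⟨Λ, hΛ, hstat, hslack⟩ :=
    exists_multiplier D.fLin (D.dG r) hr (D.isSymm_dG r) hq₀ hcon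
  refine hns ⟨Λ, fun q => ?_, hr, hΛ, hslack⟩
  have h := D.hasLineDerivAt_lagrangian r q Λ
  have h0 : D.f q + (Λ * D.dG r q).trace = 0 := hstat q
  rwa [h0] at h

/-- Outside the `F1` block `G` is affine, so its linearization there is exact. -/
theorem linear_constraints_of_negSemidef (D : SelData nx nw nz m nu) {p q : Vars nx nu} {t : ℝ}
    (h : NegSemidef (D.G p + t • D.dG p q)) :
    NegSemidef (D.F2 (p + t • q)) ∧ D.H *ᵥ (p + t • q).sel ≤ D.h ∧ 0 ≤ (p + t • q).sel ∧
      (p + t • q).sel ≤ 1 := by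
  have h1 : NegSemidef (D.G p + t • D.dG p q).toBlocks₂₂ := PosSemidef.submatrix h Sum.inr
  have h2 : (D.G (p + t • q)).toBlocks₂₂ = (D.G p + t • D.dG p q).toBlocks₂₂ := by
    rw [G_add_smul]
    ext i j
    simp [toBlocks₂₂]
  rw [← h2, G, toBlocks_fromBlocks₂₂] at h1
  simpa only [negSemidef_fromBlocks_zero, negSemidef_diagonal, sub_nonpos, neg_nonpos] using h1

theorem negSemidef_G_add_smul_dG (D : SelData nx nw nz m nu) {p q : Vars nx nu} {t : ℝ}
    (ht0 : 0 ≤ t) (ht1 : t ≤ 1) (hp : p ∈ D.feasible) (hq : NegSemidef (D.G p + D.dG p q)) :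
    NegSemidef (D.G p + t • D.dG p q) := by
  have hp : NegSemidef (D.G p) := hp
  convert (hp.smul (sub_nonneg.2 ht1)).add (hq.smul ht0) using 1
  module

/-- A short step along a strictly feasible direction satisfies the surrogate constraint
strictly. -/
theorem eventually_negDef_margin (D : SelData nx nw nz m nu) (a b : ℝ) {p q : Vars nx nu}
    (hp : p ∈ D.feasible) (hq : NegDef (D.G p + D.dG p q)) :
    ∀ᶠ t in 𝓝[>] (0 : ℝ), NegDef (D.margin a b (p + t • q) p) := by
  set E : Matrix (Fin nx ⊕ Fin nw) (Fin nx ⊕ Fin nw) ℝ :=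
    fromBlocks (a • ((D.Bu * q.selMat) * (D.Bu * q.selMat)ᵀ) + b • (q.Zᵀ * q.Z)) 0 0 0 with hE
  have hEs : E.IsSymm := by
    simp [hE, IsSymm, fromBlocks_transpose, Matrix.mul_assoc]
  have hF1 : NegSemidef (D.F1 p) := (D.negSemidef_G.1 hp).1
  have hlin : NegDef (D.F1 p + D.dF1 p q) := by
    rw [G, dG, LinearMap.coe_mk, AddHom.coe_mk, fromBlocks_add] at hq
    exact hq.fromBlocks_left
  have hten : Tendsto (fun t : ℝ => D.F1 p + D.dF1 p q + t • E) (𝓝[>] 0)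
      (𝓝 (D.F1 p + D.dF1 p q)) := by
    have hc : Continuous fun t : ℝ => D.F1 p + D.dF1 p q + t • E := by fun_prop
    simpa using (hc.tendsto 0).mono_left nhdsWithin_le_nhds
  have hev := hlin.eventually_of_tendsto hten fun t =>
    (negDef_iff.1 hlin).1.add (hEs.smul t)
  have hlt : ∀ᶠ t in 𝓝[>] (0 : ℝ), t < 1 :=
    (eventually_lt_nhds zero_lt_one).filter_mono nhdsWithin_le_nhds
  filter_upwards [hev, hlt, self_mem_nhdsWithin] with t ht ht1 ht0
  -- The margin at `p + t q` equals `(1 - t) F1 + t (F1 + dF1 + t E)`.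
  convert (hF1.smul (sub_nonneg.2 ht1.le)).add_negDef (ht.smul ht0) using 1
  rw [margin_add_smul]
  module

/-- Apply `a b ≥ -(a² + b²) / 2` to each term; this turns a norm bound into a lower bound on `f`. -/
theorem neg_le_f (D : SelData nx nw nz m nu) (p : Vars nx nu) :
    -(((D.eta + 1) ^ 2 + ∑ i, D.alphaPi i ^ 2 + p.normSq) / 2) ≤ D.f p := by
  have h1 : -(∑ i, (D.alphaPi i ^ 2 + p.sel i ^ 2) / 2) ≤ D.alphaPi ⬝ᵥ p.sel := by
    rw [← Finset.sum_neg_distrib]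
    exact Finset.sum_le_sum fun i _ => by nlinarith [sq_nonneg (D.alphaPi i + p.sel i)]
  rw [← Finset.sum_div, Finset.sum_add_distrib] at h1
  have h2 := frobSq_nonneg p.S
  have h3 := frobSq_nonneg p.Z
  unfold normSq f
  nlinarith [sq_nonneg (D.eta + 1 + p.zeta)]

namespace IsRun

variable {D : SelData nx nw nz m nu} {ρ c₁ c₂ c₃ : ℝ} {p : ℕ → Vars nx nu}
  {Q : ℕ → Matrix (InputIdx nu) (InputIdx nu) ℝ}

theorem mem_feasible (hrun : D.IsRun ρ c₁ c₂ c₃ p Q) : ∀ k, p k ∈ D.feasible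
  | 0 => hrun.init_p
  | k + 1 => (hrun.step k).1.mem_feasible

theorem antitone_f (hrun : D.IsRun ρ c₁ c₂ c₃ p Q) (hρ : 0 ≤ ρ) (hc₁ : 0 ≤ c₁) (hc₃ : 0 ≤ c₃) :
    Antitone fun k => D.f (p k) := by
  refine antitone_nat_of_succ_le fun k => ?_
  obtain ⟨hfeas, hopt⟩ := hrun.step k
  have h := hopt _ _ (hfeas.self hc₁ hc₃ (hrun.mem_feasible k))
  rw [subObj, subObj, prox_self, mul_zero, add_zero] at h
  have := mul_nonneg hρ (prox_nonneg (p (k + 1)) (p k))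
  linarith

theorem isStationary_of_mapClusterPt (hrun : D.IsRun ρ c₁ c₂ c₃ p Q) (hρ : 0 ≤ ρ)
    (hc₁ : 0 < c₁) (hc₂ : 0 < c₂) (hc₃ : 0 < c₃) {l : ℝ}
    (hl : Tendsto (fun k => D.f (p k)) atTop (𝓝 l)) {r : Vars nx nu} (hM : D.MFCQ r)
    (hr : MapClusterPt r atTop p) : D.IsStationary r := by
  -- The ultrafilter plays the role of a subsequence converging to `r`.
  obtain ⟨U, hU, hUr⟩ := mapClusterPt_iff_ultrafilter.1 hr
  have hrf : r ∈ D.feasible :=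
    D.isClosed_feasible.mem_of_tendsto hUr (Eventually.of_forall hrun.mem_feasible)
  by_contra hns
  obtain ⟨d, hd, hfd⟩ := D.exists_descent_direction hrf hM hns
  have hfr : D.f r = l :=
    tendsto_nhds_unique ((D.continuous_f.tendsto r).comp hUr) (hl.mono_left hU)
  set K : ℝ := d.zeta ^ 2 + frobSq d.S + frobSq d.Z + frobSq d.selMat with hK
  have hdec : ∀ᶠ t in 𝓝[>] (0 : ℝ), D.f d + ρ * (t * K) < 0 := by
    have hc : Continuous fun t : ℝ => D.f d + ρ * (t * K) := by fun_prop
    exact (hc.tendsto 0).mono_left nhdsWithin_le_nhds |>.eventually_lt_const (by simpa using hfd)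
  have hlt : ∀ᶠ t in 𝓝[>] (0 : ℝ), t < 1 :=
    (eventually_lt_nhds zero_lt_one).filter_mono nhdsWithin_le_nhds
  obtain ⟨t, ⟨⟨hmar, hneg⟩, ht1⟩, ht0 : 0 < t⟩ :=
    (((D.eventually_negDef_margin (c₃⁻¹ * c₂ ^ 2) c₁⁻¹ hrf hd).and hdec).and hlt |>.and
      self_mem_nhdsWithin).exists
  obtain ⟨hF2, hH, h0, h1⟩ := D.linear_constraints_of_negSemidef
    (D.negSemidef_G_add_smul_dG ht0.le ht1.le hrf hd.negSemidef)
  have hev : ∀ᶠ k in (U : Filter ℕ),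
      NegDef (D.margin (c₃⁻¹ * c₂ ^ 2) c₁⁻¹ (r + t • d) (p k)) :=
    hmar.eventually_of_tendsto (((D.continuous_margin _ _ _).tendsto r).comp hUr)
      fun k => D.isSymm_margin _ _ _ _
  have hle : ∀ᶠ k in (U : Filter ℕ),
      D.f (p (k + 1)) ≤ D.f (r + t • d) + ρ * (r + t • d).prox (p k) := by
    -- Index 0 is excluded because `Q 0 = 1` need not obey the bounds `c₁` and `c₂`.
    filter_upwards [hev, hU (eventually_ge_atTop 1)] with k hk hk1
    obtain ⟨j, rfl⟩ : ∃ j, k = j + 1 := ⟨k - 1, by omega⟩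
    have hprev := (hrun.step j).1
    obtain ⟨hfeas, hopt⟩ := hrun.step (j + 1)
    have hQpsd : (Q (j + 1)).PosSemidef := by
      simpa using hprev.lower.add (PosSemidef.one.smul hc₁.le)
    -- The competitor borrows the optimal `Q`, which already meets all constraints on `Q` alone.
    have h := hopt (r + t • d) (Q (j + 1 + 1))
      ⟨hfeas.symm, D.negSemidef_Ks_of_margin hc₁ hc₂ hc₃ hprev.symm hQpsd hprev.upper hfeas.lower
        hfeas.gap hk.negSemidef, hfeas.lower, hfeas.upper, hfeas.gap, hF2, hH, h0, h1⟩
    have := mul_nonneg hρ (prox_nonneg (p (j + 1 + 1)) (p (j + 1)))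
    rw [subObj, subObj] at h
    linarith
  have hlim1 : Tendsto (fun k => D.f (p (k + 1))) U (𝓝 l) :=
    (hl.comp (tendsto_add_atTop_nat 1)).mono_left hU
  have hlim2 : Tendsto (fun k => D.f (r + t • d) + ρ * (r + t • d).prox (p k)) U
      (𝓝 (D.f (r + t • d) + ρ * (r + t • d).prox r)) :=
    ((((continuous_prox (r + t • d)).tendsto r).comp hUr).const_mul ρ).const_add _
  have hfin := le_of_tendsto_of_tendsto hlim1 hlim2 hle
  rw [f_add_smul, prox_add_smul, hfr, ← hK] at hfin
  nlinarith

end IsRun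

end SelData

/-! ### Assembly -/

theorem proposition7 {nx nw nz m N : ℕ} {nu : Fin N → ℕ}
    (D : SelData nx nw nz m nu) (halpha : 0 < D.alpha) (heta : 0 < D.eta)
    (ρ c₁ c₂ c₃ : ℝ) (hρ : 0 < ρ) (hc₁ : 0 < c₁) (hc₂ : 0 < c₂) (hc₃ : 0 < c₃)
    (p : ℕ → Vars nx nu) (Q : ℕ → Matrix (InputIdx nu) (InputIdx nu) ℝ)
    (hrun : D.IsRun ρ c₁ c₂ c₃ p Q)
    (hMFCQ : ∀ r ∈ D.feasible, D.MFCQ r)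
    (hbdd : ∃ C : ℝ, ∀ k : ℕ, 1 ≤ k → (p k).normSq ≤ C) :
    (∀ k : ℕ, 1 ≤ k →
      D.optVal ≤ (D.f (p k) : EReal) ∧
      D.optVal ≤ D.subVal ρ c₁ c₂ c₃ (p (k - 1)) (Q (k - 1))) ∧
    (AntitoneOn (fun k => D.f (p k)) (Set.Ici 1) ∧
      ∃ l : ℝ, Tendsto (fun k => D.f (p k)) atTop (𝓝 l) ∧ D.optVal ≤ (l : EReal)) ∧
    (∀ r : Vars nx nu, MapClusterPt r atTop p → D.IsStationary r) := by
  have hfeas := hrun.mem_feasible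
  have hval : ∀ r ∈ D.feasible, D.optVal ≤ (D.f r : EReal) := fun r hr => iInf₂_le r hr
  have hanti := hrun.antitone_f hρ.le hc₁.le hc₃.le
  obtain ⟨C, hC⟩ := hbdd
  have hbelow : BddBelow (Set.range fun k => D.f (p k)) := by
    refine ⟨-(((D.eta + 1) ^ 2 + ∑ i, D.alphaPi i ^ 2 + C) / 2), ?_⟩
    rintro _ ⟨k, rfl⟩
    -- The norm bound starts at index 1, so it is used at `k + 1` and passed back to `k` by
    -- monotonicity.
    have h1 := D.neg_le_f (p (k + 1))
    have h2 := hC (k + 1) (by omega)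
    have h3 : D.f (p (k + 1)) ≤ D.f (p k) := hanti k.le_succ
    simp only
    linarith
  have hl := tendsto_atTop_ciInf hanti hbelow
  refine ⟨fun k _ => ⟨hval _ (hfeas k), ?_⟩, ⟨hanti.antitoneOn _, _, hl, ?_⟩, fun r hr => ?_⟩
  · refine le_iInf fun r => le_iInf fun R => le_iInf fun hrR => ?_
    refine (hval r hrR.mem_feasible).trans (EReal.coe_le_coe_iff.2 ?_)
    have := mul_nonneg hρ.le (Vars.prox_nonneg r (p (k - 1)))
    rw [SelData.subObj]
    linarith
  · exact ge_of_tendsto ((continuous_coe_real_ereal.tendsto _).comp hl)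
      (Eventually.of_forall fun k => hval _ (hfeas k))
  · refine hrun.isStationary_of_mapClusterPt hρ.le hc₁ hc₂ hc₃ hl (hMFCQ r ?_) hr
    exact D.isClosed_feasible.mem_of_mapClusterPt hr (Eventually.of_forall hfeas)
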